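/- Let $p$ be an odd prime, let $n$ and $r$ be positive integers, $v=\gcd(n,r)$, and $t=n/2$ when $n$ is even. Let $\mathrm{Tr}$ be the absolute trace from $\mathbb{F}_{p^n}$ to $\mathbb{F}_p$. For $h\ge 1$ let $G_h=\sum_{x\in\mathbb{F}_{p^h}}\eta_h(x)\,e^{2\pi i\,\mathrm{Tr}_h(x)/p}$ be the quadratic Gauss sum over $\mathbb{F}_{p^h}$, where $\eta_h$ is the quadratic character of $\mathbb{F}_{p^h}$ (with $\eta_h(0)=0$) and $\mathrm{Tr}_h$ is the absolute trace of $\mathbb{F}_{p^h}$, and let $\eta'=\eta_1$ be the quadratic character of $\mathbb{F}_p$. For $a\in\mathbb{F}_{p^n}$ and $b\in\mathbb{F}_p$ put $$N(a,b)=\bigl|\{x\in\mathbb{F}_{p^n}:\mathrm{Tr}(ax-x^{p^r+1})=b\}\bigr|.$$ For $a\neq 0$ consider the equation $$X^{p^{2r}}+X=-a^{p^r}\qquad(\ast)$$ over $\mathbb{F}_{p^n}$. In cases (1)--(3) below it is solvable. Whenever it is solvable, let $\gamma_a\in\mathbb{F}_{p^n}$ be any solution and put $\lambda=\mathrm{Tr}(\gamma_a^{p^r+1})$.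 (1) If $n$ is odd, then $$N(a,b)=\begin{cases}p^{n-1},&a=0,\ b=0\ \text{ or }\ a\ne0,\ \lambda=b,\\ p^{n-1}+p^{-1}G_nG_1\eta'(b),&a=0,\ b\ne0,\\ p^{n-1}+p^{-1}G_nG_1\eta'(b-\lambda),&a\neq0,\ \lambda\ne b.\end{cases}$$ (2) If $n$ is even and $n/v$ is odd, then $$N(a,b)=\begin{cases}p^{n-1}+p^{-1}(p-1)G_n,&a=0,\ b=0\ \text{ or }\ a\ne0,\ \lambda=b,\\ p^{n-1}-p^{-1}G_n,&a=0,\ b\ne0\ \text{ or }\ a\ne0,\ \lambda\ne b.\end{cases}$$ (3) If $n/v$ is even and $n/(2v)$ is odd, then $$N(a,b)=\begin{cases}p^{n-1}-(p-1)p^{t-1},&a=0,\ b=0\ \text{ or }\ a\ne0,\ \lambda=b,\\ p^{n-1}+p^{t-1},&a=0,\ b\ne0\ \text{ or }\ a\ne0,\ \lambda\ne b.\end{cases}$$ (4) If $n/v$ is even and $n/(2v)$ is even, then for each $y\in\mathbb{F}_p^*$ the equation $$(-y)^{p^r}X^{p^{2r}}+(-y)X=-(ya)^{p^r}\qquad(\ast_y)$$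 is solvable in $\mathbb{F}_{p^n}$ if and only if $(\ast)$ is (for $a\ne0$), and $$N(a,b)=\begin{cases}p^{n-1}-(p-1)p^{t+v-1},&a=0,\ b=0\ \text{ or }\ a\ne0,\ \lambda=b,\ (\ast_y)\text{ solvable},\\ p^{n-1}+p^{t+v-1},&a=0,\ b\ne0\ \text{ or }\ a\ne0,\ \lambda\ne b,\ (\ast_y)\text{ solvable},\\ p^{n-1},&a\ne0,\ (\ast_y)\text{ unsolvable}.\end{cases}$$ -/

import Mathlib

/-- The number `N(a, b)` of `x` in the finite field `F` of characteristic `p` with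
`Tr(a x - x ^ (p ^ r + 1)) = b`, where `Tr` is the absolute trace `F → 𝔽_p`. -/
noncomputable def traceCount (p r : ℕ) [Fact p.Prime] {F : Type*} [Field F] [Algebra (ZMod p) F]
    (a : F) (b : ZMod p) : ℕ :=
  Nat.card {x : F // Algebra.trace (ZMod p) F (a * x - x ^ (p ^ r + 1)) = b}

/-- The canonical additive character `x ↦ exp (2 π i Tr(x) / p)` of `F`. -/
noncomputable def canonicalAddChar (p : ℕ) [Fact p.Prime] (F : Type*) [Field F]
    [Algebra (ZMod p) F] : AddChar F ℂ :=
  (ZMod.stdAddChar (N := p)).compAddMonoidHom (Algebra.trace (ZMod p) F).toAddMonoidHom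

/-- The quadratic Gauss sum `∑ x, η(x) χ₁(x)` over `F`, where `η` is the quadratic character
and `χ₁` is the canonical additive character of `F`. -/
noncomputable def quadGauss (p : ℕ) [Fact p.Prime] (F : Type*) [Field F] [Fintype F]
    [DecidableEq F] [Algebra (ZMod p) F] : ℂ :=
  ∑ x : F, ((quadraticChar F x : ℤ) : ℂ) * canonicalAddChar p F x

/-- `γ` is a solution of `X ^ (p ^ (2 r)) + X = - a ^ (p ^ r)`. -/
def IsGamma (p r : ℕ) {F : Type*} [Field F] (a γ : F) : Prop :=
  γ ^ (p ^ (2 * r)) + γ = -(a ^ (p ^ r))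

/-- The equation `(-y) ^ (p ^ r) X ^ (p ^ (2 r)) + (-y) X = - (y a) ^ (p ^ r)`, with
`y` in the prime field, has a solution in `F`. -/
def ScaledSolvable (p r : ℕ) {F : Type*} [Field F] [Algebra (ZMod p) F]
    (y : ZMod p) (a : F) : Prop :=
  ∃ x : F, (-(algebraMap (ZMod p) F y)) ^ (p ^ r) * x ^ (p ^ (2 * r))
    + (-(algebraMap (ZMod p) F y)) * x = -((algebraMap (ZMod p) F y * a) ^ (p ^ r))

/-- The value `λ = Tr(γ ^ (p ^ r + 1))`. -/
noncomputable def lam (p r : ℕ) [Fact p.Prime] {F : Type*} [Field F] [Algebra (ZMod p) F]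
    (γ : F) : ZMod p :=
  Algebra.trace (ZMod p) F (γ ^ (p ^ r + 1))

/-!
Write `Q(x) = Tr(x ^ (p ^ r + 1))` (`lam`), a quadratic form over `𝔽_p` with polar form
`B(x, y) = Tr(x ^ (p ^ r) * L(y))`, where `L(y) = y ^ (p ^ (2 r)) + y`. Its radical is `ker L`, and
`Q` vanishes there because `p` is odd.

*Removing the linear term.* If `L(γ) = -a ^ (p ^ r)`, the substitution `x = y - γ` turns
`Tr(a x) - Q(x)` into `λ - Q(y)`, so `N(a, b) = N(0, b - λ)` (`traceCount_eq_of_isGamma`). Duality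
for the trace form shows that if no such `γ` exists, then `Tr(a k) ≠ 0` for some `k ∈ ker L`
(`exists_isGamma_or_exists_trace_ne_zero`); translation along `k` then makes all the fibres equally
large (`traceCount_of_trace_ne_zero`). So only the counts `N(0, b)` and the kernel of `L` remain.

*Fourier inversion.* The counts `N(0, b)` are determined by the Weil sums
`W(c) = ∑ x, ζ ^ (c Q(x))` with `c ∈ 𝔽_p` (`mul_traceCount_zero`).

*`n / v` odd.* An element of `ker L` lies in the subfield of degree `gcd(n, 4 r) = v`, on which
`L(x) = 2 x`, so `ker L = 0`. Similarly `x ^ (p ^ r + 1) = 1` only for `x = ± 1`, hence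
`x ^ (p ^ r + 1)` has the same distribution as `x ^ 2` and `W(c) = η(c) G_n`
(`weilSum_of_odd_div_gcd`); on `𝔽_p` the character `η` is the `n`-th power of `η'`.

*`n / v` even.* Here `r ≡ v` modulo `2 v`, so on the subfield of degree `2 v` the map
`w ↦ w ^ (p ^ r + 1)` is the norm to the subfield of degree `v`. Every element of `𝔽_p` is such a
norm, so `W(c)` does not depend on `c ≠ 0` and is an integer. The `p ^ v + 1` elements of norm `1`
act freely on each fibre of `Q` over a nonzero value, so `W ≡ 1` modulo `p ^ v + 1`. Finally
`W ^ 2 = p ^ n * |ker L|` (`weilSum_mul_conj`), and `ker L` is `0` or has `p ^ (2 v)` elements. This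
gives `W = ± p ^ w`, where `w = t` or `w = t + v` is an odd multiple of `v`. Since
`p ^ w ≡ -1` modulo `p ^ v + 1`, the congruence forces `W = -p ^ w` (`weilSum_eq_neg_pow`).
-/

open Finset

/-! ### Frobenius powers and the absolute trace -/

section Frobenius

variable (p : ℕ) [Fact p.Prime] {F : Type*} [Field F] [Fintype F] [Algebra (ZMod p) F]

/-- The iterated Frobenius `x ↦ x ^ (p ^ r)` as an automorphism of `F` over its prime field. -/
noncomputable def frobPow (r : ℕ) (F : Type*) [Field F] [Fintype F] [Algebra (ZMod p) F] :
    F ≃ₐ[ZMod p] F :=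
  FiniteField.frobeniusAlgEquivOfAlgebraic (ZMod p) F ^ r

theorem frobPow_apply (r : ℕ) (x : F) : frobPow p r F x = x ^ (p ^ r) := by
  rw [frobPow, AlgEquiv.coe_pow, FiniteField.coe_frobeniusAlgEquivOfAlgebraic_iterate, ZMod.card]

theorem trace_pow_prime_pow (r : ℕ) (x : F) :
    Algebra.trace (ZMod p) F (x ^ (p ^ r)) = Algebra.trace (ZMod p) F x := by
  rw [← frobPow_apply, Algebra.trace_eq_of_algEquiv]

theorem add_pow_prime_pow (r : ℕ) (x y : F) :
    (x + y) ^ (p ^ r) = x ^ (p ^ r) + y ^ (p ^ r) := by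
  simp only [← frobPow_apply, map_add]

theorem neg_pow_prime_pow (r : ℕ) (x : F) : (-x) ^ (p ^ r) = -x ^ (p ^ r) := by
  simp only [← frobPow_apply, map_neg]

theorem algebraMap_pow_prime_pow (r : ℕ) (c : ZMod p) :
    algebraMap (ZMod p) F c ^ (p ^ r) = algebraMap (ZMod p) F c := by
  rw [← frobPow_apply, AlgEquiv.commutes]

theorem exists_trace_mul_ne_zero {x : F} (hx : x ≠ 0) :
    ∃ y : F, Algebra.trace (ZMod p) F (x * y) ≠ 0 := by
  have htr := (traceForm_nondegenerate (ZMod p) F).1 x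
  simp_rw [Algebra.traceForm_apply] at htr
  by_contra! hf
  exact hx (htr hf)

omit [Fintype F] in
theorem two_ne_zero_of_algebra_zmod (hp : p ≠ 2) : (2 : F) ≠ 0 := by
  have : CharP F p := charP_of_injective_algebraMap (algebraMap (ZMod p) F).injective p
  exact Ring.two_ne_zero (by rwa [ringChar.eq F p])

omit [Fintype F] in
theorem ringChar_ne_two_of_algebra_zmod (hp : p ≠ 2) : ringChar F ≠ 2 := by
  have : CharP F p := charP_of_injective_algebraMap (algebraMap (ZMod p) F).injective p
  rwa [ringChar.eq F p]

end Frobenius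

/-! ### Elements fixed by a power of Frobenius -/

section FixedFields

variable {p : ℕ} {F : Type*} [Monoid F]

theorem isPeriodicPt_pow_iff {k : ℕ} {x : F} :
    Function.IsPeriodicPt (fun z : F => z ^ p) k x ↔ x ^ (p ^ k) = x := by
  rw [Function.IsPeriodicPt, pow_iterate, Function.IsFixedPt]

theorem pow_prime_pow_gcd {i j : ℕ} {x : F} (hi : x ^ (p ^ i) = x) (hj : x ^ (p ^ j) = x) :
    x ^ (p ^ Nat.gcd i j) = x :=
  isPeriodicPt_pow_iff.1 ((isPeriodicPt_pow_iff.2 hi).gcd (isPeriodicPt_pow_iff.2 hj))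

theorem pow_prime_pow_of_dvd {i j : ℕ} {x : F} (hi : x ^ (p ^ i) = x) (hij : i ∣ j) :
    x ^ (p ^ j) = x :=
  isPeriodicPt_pow_iff.1 ((isPeriodicPt_pow_iff.2 hi).trans_dvd hij)

theorem pow_prime_pow_congr {i j k : ℕ} {x : F} (hi : x ^ (p ^ i) = x) (hjk : j ≡ k [MOD i]) :
    x ^ (p ^ j) = x ^ (p ^ k) := by
  have h := isPeriodicPt_pow_iff.2 hi
  have h1 := h.iterate_mod_apply j
  have h2 := h.iterate_mod_apply k
  simp only [pow_iterate] at h1 h2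
  rw [← h1, ← h2, hjk]

end FixedFields

/-! ### The quadratic form and its radical -/

section QuadraticForm

variable (p : ℕ) [Fact p.Prime] {F : Type*} [Field F] [Fintype F] [Algebra (ZMod p) F]

/-- The polar form of `lam`, with `Tr(x * y ^ (p ^ r))` rewritten by Frobenius invariance of the
trace so as to isolate `y ^ (p ^ (2 r)) + y`. -/
theorem lam_add (r : ℕ) (x y : F) :
    lam p r (x + y) = lam p r x + lam p r y
      + Algebra.trace (ZMod p) F (x ^ (p ^ r) * (y ^ (p ^ (2 * r)) + y)) := by
  have h : Algebra.trace (ZMod p) F (x ^ (p ^ r) * y ^ (p ^ (2 * r)))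
      = Algebra.trace (ZMod p) F (x * y ^ (p ^ r)) := by
    rw [← trace_pow_prime_pow p r (x * y ^ (p ^ r)), mul_pow, ← pow_mul, ← pow_add, two_mul]
  rw [mul_add, map_add, h]
  simp only [lam]
  rw [pow_succ, add_pow_prime_pow, ← map_add, ← map_add, ← map_add]
  congr 1
  ring

theorem lam_neg (r : ℕ) (x : F) : lam p r (-x) = lam p r x := by
  rw [lam, lam, pow_succ, neg_pow_prime_pow, neg_mul_neg, ← pow_succ]

omit [Fintype F] in
theorem lam_zero (r : ℕ) : lam p r (0 : F) = 0 := by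
  simp [lam]

/-- The form `Tr(x ^ (p ^ r + 1))` vanishes on the radical of its polar form. -/
theorem lam_eq_zero_of_mem_radical (hp : p ≠ 2) {r : ℕ} {x : F} (hx : x ^ (p ^ (2 * r)) + x = 0) :
    lam p r x = 0 := by
  have h := lam_add p r (-x) x
  rw [hx, mul_zero, map_zero, add_zero, lam_neg, neg_add_cancel, lam_zero, ← two_mul] at h
  exact (mul_eq_zero.1 h.symm).resolve_left (two_ne_zero_of_algebra_zmod p hp)

/-- Completing the square: the substitution `x = y - γ` removes the linear term. -/
theorem traceCount_eq_of_isGamma (r : ℕ) {a γ : F} (h : IsGamma p r a γ) (b : ZMod p) :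
    traceCount p r a b = traceCount p r (0 : F) (b - lam p r γ) := by
  have key (y : F) : Algebra.trace (ZMod p) F (a * (y - γ) - (y - γ) ^ (p ^ r + 1))
      = Algebra.trace (ZMod p) F (0 * y - y ^ (p ^ r + 1)) + lam p r γ := by
    have hlin (z : F) : Algebra.trace (ZMod p) F (a * z)
        = -Algebra.trace (ZMod p) F (z ^ (p ^ r) * (γ ^ (p ^ (2 * r)) + γ)) := by
      rw [h, ← trace_pow_prime_pow p r (a * z), mul_pow, mul_neg, map_neg, neg_neg, mul_comm]
    have h1 := lam_add p r y (-γ)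
    have h2 := lam_add p r γ (-γ)
    rw [add_neg_cancel, lam_zero, lam_neg] at h2
    rw [neg_pow_prime_pow, ← neg_add, mul_neg, map_neg] at h1 h2
    rw [lam_neg] at h1
    rw [map_sub, map_sub, zero_mul, map_zero, mul_sub, map_sub, hlin, hlin]
    change _ - lam p r (y - γ) = 0 - lam p r y + _
    rw [sub_eq_add_neg y γ, h1]
    linear_combination h2
  unfold traceCount
  refine Nat.card_congr ((Equiv.addRight γ).subtypeEquiv fun x => ?_)
  have := key (x + γ)
  rw [add_sub_cancel_right] at this
  rw [this, Equiv.coe_addRight, eq_sub_iff_add_eq]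

/-- Fredholm alternative for `X ^ (p ^ (2 r)) + X`: a right-hand side is attained unless some
element of the kernel pairs nontrivially with it. -/
theorem exists_isGamma_or_exists_trace_ne_zero (r : ℕ) (a : F) :
    (∃ γ : F, IsGamma p r a γ) ∨
      ∃ k : F, k ^ (p ^ (2 * r)) + k = 0 ∧ Algebra.trace (ZMod p) F (a * k) ≠ 0 := by
  by_contra! hcon
  obtain ⟨hno, hk⟩ := hcon
  let L : F →ₗ[ZMod p] F := (frobPow p (2 * r) F).toLinearMap + LinearMap.id
  have hL (x : F) : L x = x ^ (p ^ (2 * r)) + x := by simp [L, frobPow_apply]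
  let φ : Module.Dual (ZMod p) F := Algebra.traceForm (ZMod p) F a
  have hφ : φ ∈ L.ker.dualAnnihilator := by
    rw [Submodule.mem_dualAnnihilator]
    intro x hx
    rw [LinearMap.mem_ker, hL] at hx
    exact hk x hx
  rw [← LinearMap.range_dualMap_eq_dualAnnihilator_ker] at hφ
  obtain ⟨f, hf⟩ := hφ
  obtain ⟨w, rfl⟩ := (LinearMap.BilinForm.toDual (Algebra.traceForm (ZMod p) F)
    (traceForm_nondegenerate (ZMod p) F)).surjective f
  have hw (x : F) : Algebra.trace (ZMod p) F (w * (x ^ (p ^ (2 * r)) + x))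
      = Algebra.trace (ZMod p) F (a * x) := by
    have := LinearMap.congr_fun hf x
    rw [LinearMap.dualMap_apply, hL, LinearMap.BilinForm.toDual_def] at this
    exact this
  -- nondegeneracy turns the trace identity `hw` into an equation for `w`; the solution `γ` is then
  -- the preimage of `-w` under `x ↦ x ^ (p ^ r)`
  have hzero : w + w ^ (p ^ (2 * r)) - a ^ (p ^ (2 * r)) = 0 := by
    by_contra hne
    obtain ⟨y, hy⟩ := exists_trace_mul_ne_zero p hne
    obtain ⟨x, rfl⟩ := (frobPow p (2 * r) F).surjective y
    rw [frobPow_apply, sub_mul, add_mul, ← mul_pow, ← mul_pow, map_sub, map_add,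
      trace_pow_prime_pow, trace_pow_prime_pow, ← hw, mul_add, map_add, sub_self] at hy
    exact hy rfl
  obtain ⟨γ, hγ⟩ := (frobPow p r F).surjective (-w)
  rw [frobPow_apply] at hγ
  refine hno γ ((frobPow p r F).injective ?_)
  have h2 : (a ^ p ^ r) ^ p ^ r = a ^ (p ^ (2 * r)) := by
    rw [← pow_mul, ← pow_add, two_mul]
  have h3 : (γ ^ p ^ (2 * r)) ^ p ^ r = (γ ^ p ^ r) ^ p ^ (2 * r) := by
    rw [← pow_mul, ← pow_mul, mul_comm]
  rw [frobPow_apply, frobPow_apply, add_pow_prime_pow, neg_pow_prime_pow, h2, h3, hγ,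
    neg_pow_prime_pow]
  linear_combination -hzero

/-- If `ker (X ^ (p ^ (2 r)) + X)` pairs nontrivially with `a`, translation along the kernel
permutes the fibres of `x ↦ Tr(a x - x ^ (p ^ r + 1))` transitively. -/
theorem traceCount_of_trace_ne_zero (hp : p ≠ 2) {n : ℕ} (hn : 0 < n)
    (hF : Fintype.card F = p ^ n) {r : ℕ} {a k : F}
    (hk : k ^ (p ^ (2 * r)) + k = 0) (hak : Algebra.trace (ZMod p) F (a * k) ≠ 0) (b : ZMod p) :
    traceCount p r a b = p ^ (n - 1) := by
  have hshift (c : ZMod p) (x : F) :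
      Algebra.trace (ZMod p) F (a * (x + c • k) - (x + c • k) ^ (p ^ r + 1))
        = Algebra.trace (ZMod p) F (a * x - x ^ (p ^ r + 1))
          + c * Algebra.trace (ZMod p) F (a * k) := by
    have hck : (c • k) ^ (p ^ (2 * r)) + c • k = 0 := by
      rw [Algebra.smul_def, mul_pow, algebraMap_pow_prime_pow, ← mul_add, hk, mul_zero]
    have h1 := lam_add p r x (c • k)
    rw [hck, lam_eq_zero_of_mem_radical p hp hck, mul_zero, map_zero, add_zero, add_zero] at h1
    rw [map_sub, map_sub]
    change _ - lam p r _ = _ - lam p r _ + _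
    rw [h1, mul_add, map_add, mul_smul_comm, map_smul, smul_eq_mul]
    ring
  have hconst (b' : ZMod p) : traceCount p r a b' = traceCount p r a b := by
    unfold traceCount
    refine Nat.card_congr ((Equiv.addRight
      (((b - b') / Algebra.trace (ZMod p) F (a * k)) • k)).subtypeEquiv fun x => ?_)
    rw [Equiv.coe_addRight, hshift, div_mul_cancel₀ _ hak]
    constructor
    · rintro rfl; ring
    · intro h; linear_combination h
  have hsum : ∑ b' : ZMod p, traceCount p r a b' = p ^ n := by
    rw [← hF, ← Nat.card_eq_fintype_card]
    simp only [traceCount]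
    rw [← Nat.card_sigma]
    exact Nat.card_congr (Equiv.sigmaFiberEquiv _)
  simp only [hconst, sum_const, card_univ, ZMod.card, smul_eq_mul] at hsum
  refine Nat.eq_of_mul_eq_mul_left (Fact.out : p.Prime).pos ?_
  rw [hsum, ← pow_succ', Nat.sub_add_cancel hn]

/-- Solvability of the scaled equation does not depend on the scalar. -/
theorem scaledSolvable_iff (r : ℕ) {y : ZMod p} (hy : y ≠ 0) (a : F) :
    ScaledSolvable p r y a ↔ ∃ γ : F, IsGamma p r a γ := by
  have hy' : algebraMap (ZMod p) F y ≠ 0 := by simpa using hy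
  unfold ScaledSolvable IsGamma
  rw [(Equiv.neg F).exists_congr_left]
  refine exists_congr fun x => ?_
  rw [neg_pow_prime_pow, mul_pow, algebraMap_pow_prime_pow, Equiv.neg_symm, Equiv.neg_apply,
    neg_pow_prime_pow]
  constructor
  · intro h
    refine mul_left_cancel₀ hy' ?_
    linear_combination h
  · intro h
    linear_combination algebraMap (ZMod p) F y * h

end QuadraticForm

/-! ### Weil sums -/

section CharacterSums

variable (p : ℕ) [Fact p.Prime] {F : Type*} [Field F] [Fintype F] [Algebra (ZMod p) F]

omit [Fintype F] in
theorem canonicalAddChar_apply (x : F) :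
    canonicalAddChar p F x = ZMod.stdAddChar (Algebra.trace (ZMod p) F x) := rfl

theorem sum_canonicalAddChar_mul (w : F) :
    ∑ x : F, canonicalAddChar p F (w * x)
      = open Classical in if w = 0 then (Fintype.card F : ℂ) else 0 := by
  classical
  split_ifs with hw
  · simp [hw]
  · have hne : AddChar.mulShift (canonicalAddChar p F) w ≠ 1 := by
      obtain ⟨y, hy⟩ := exists_trace_mul_ne_zero p hw
      intro h
      have h1 := ZMod.isPrimitive_stdAddChar p hy
      apply h1
      ext c
      have := DFunLike.congr_fun h (c • y)
      rw [AddChar.mulShift_apply, canonicalAddChar_apply, mul_smul_comm, map_smul,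
        smul_eq_mul, mul_comm] at this
      rw [AddChar.mulShift_apply, this]
      rfl
    have := AddChar.sum_eq_zero_of_ne_one hne
    simpa only [AddChar.mulShift_apply] using this

/-- The Weil sum `∑ x, ζ ^ (c Tr(x ^ (p ^ r + 1)))` attached to the form
`Tr(x ^ (p ^ r + 1))` scaled by `c` in the prime field, with `ζ = exp (2 π i / p)`. -/
noncomputable def weilSum (r : ℕ) (F : Type*) [Field F] [Fintype F] [Algebra (ZMod p) F]
    (c : ZMod p) : ℂ :=
  ∑ x : F, ZMod.stdAddChar (c * lam p r x)

theorem weilSum_zero (r : ℕ) : weilSum p r F 0 = Fintype.card F := by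
  simp [weilSum]

theorem sum_stdAddChar_mul (z : ZMod p) :
    ∑ y : ZMod p, ZMod.stdAddChar (y * z) = if z = 0 then (p : ℂ) else 0 := by
  have h := AddChar.sum_mulShift z (ZMod.isPrimitive_stdAddChar p)
  rw [h, ZMod.card]
  split_ifs <;> simp

/-- Fourier inversion: the counts `N(0, b)` in terms of Weil sums. -/
theorem mul_traceCount_zero (r : ℕ) (b : ZMod p) :
    (p : ℂ) * traceCount p r (0 : F) b
      = ∑ y : ZMod p, ZMod.stdAddChar (y * b) * weilSum p r F y := by
  classical
  have hcount : (traceCount p r (0 : F) b : ℂ) = ∑ x : F, if b + lam p r x = 0 then 1 else 0 := by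
    rw [traceCount, Nat.card_eq_fintype_card, Fintype.card_subtype, Finset.sum_boole]
    congr 3
    ext x
    rw [zero_mul, zero_sub, map_neg]
    change -lam p r x = b ↔ _
    rw [neg_eq_iff_add_eq_zero, add_comm]
  simp only [weilSum, mul_sum, ← AddChar.map_add_eq_mul, ← mul_add]
  rw [sum_comm, hcount, mul_sum]
  refine sum_congr rfl fun x _ => ?_
  rw [sum_stdAddChar_mul]
  split_ifs <;> simp

/-- If the Weil sums at nonzero scalars share the value `S`, then so do the counts `N(0, b)` at
nonzero `b`. -/
theorem traceCount_zero_of_weilSum_const {n : ℕ} (hn : 0 < n) (hF : Fintype.card F = p ^ n)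
    {r : ℕ} {S : ℂ} (hS : ∀ y : ZMod p, y ≠ 0 → weilSum p r F y = S) (b : ZMod p) :
    (traceCount p r (0 : F) b : ℂ) = (p : ℂ) ^ (n - 1)
      + (p : ℂ)⁻¹ * ((if b = 0 then (p : ℂ) else 0) - 1) * S := by
  have hp0 : (p : ℂ) ≠ 0 := Nat.cast_ne_zero.2 (Fact.out : p.Prime).ne_zero
  have hpn : (p : ℂ) ^ n = p * (p : ℂ) ^ (n - 1) := by
    rw [← pow_succ', Nat.sub_add_cancel hn]
  refine mul_left_cancel₀ hp0 ?_
  rw [mul_traceCount_zero, ← sum_stdAddChar_mul]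
  rw [← add_sum_erase _ _ (mem_univ (0 : ZMod p)),
    ← add_sum_erase _ (fun y : ZMod p => ZMod.stdAddChar (y * b)) (mem_univ (0 : ZMod p)),
    sum_congr rfl fun y hy => by rw [hS y (mem_erase.1 hy).1], ← sum_mul, weilSum_zero, hF]
  simp only [zero_mul, AddChar.map_zero_eq_one, Nat.cast_pow, hpn, one_mul, add_sub_cancel_left]
  rw [mul_add, mul_assoc, mul_inv_cancel_left₀ hp0]

/-- The square of the absolute value of a Weil sum is the size of the field times that of the
radical of the quadratic form. -/
theorem weilSum_mul_conj (hp : p ≠ 2) (r : ℕ) {c : ZMod p} (hc : c ≠ 0) :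
    weilSum p r F c * (starRingEnd ℂ) (weilSum p r F c)
      = Fintype.card F * Nat.card {x : F // x ^ (p ^ (2 * r)) + x = 0} := by
  classical
  have hconj : (starRingEnd ℂ) (weilSum p r F c)
      = ∑ x : F, ZMod.stdAddChar (-(c * lam p r x)) := by
    rw [weilSum, map_sum]
    exact sum_congr rfl fun x _ => (AddChar.map_neg_eq_conj _ _).symm
  -- the inner sum after substituting `x + z` for the first variable: only `z` in the radical counts
  have hsum (z : F) : ∑ x : F, ZMod.stdAddChar (c * lam p r (x + z) + -(c * lam p r x))
      = if z ^ (p ^ (2 * r)) + z = 0 then (Fintype.card F : ℂ) else 0 := by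
    have h1 (x : F) : c * lam p r (x + z) + -(c * lam p r x) = c * lam p r z
        + Algebra.trace (ZMod p) F ((c • (z ^ (p ^ (2 * r)) + z)) * frobPow p r F x) := by
      rw [lam_add, frobPow_apply, smul_mul_assoc, map_smul, smul_eq_mul, mul_comm (x ^ p ^ r)]
      ring
    simp only [h1, AddChar.map_add_eq_mul, ← mul_sum, ← canonicalAddChar_apply]
    rw [(frobPow p r F).bijective.sum_comp
      (fun x => canonicalAddChar p F ((c • (z ^ (p ^ (2 * r)) + z)) * x)),
      sum_canonicalAddChar_mul]
    simp only [smul_eq_zero, hc, false_or]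
    split_ifs with hz
    · rw [lam_eq_zero_of_mem_radical p hp hz, mul_zero, AddChar.map_zero_eq_one, one_mul]
    · rw [mul_zero]
  rw [hconj, weilSum, sum_mul_sum, sum_comm]
  simp only [← AddChar.map_add_eq_mul]
  have h2 (y : F) : ∑ x : F, ZMod.stdAddChar (c * lam p r x + -(c * lam p r y))
      = ∑ z : F, ZMod.stdAddChar (c * lam p r (y + z) + -(c * lam p r y)) :=
    (Equiv.sum_comp (Equiv.addLeft y)
      (fun x => ZMod.stdAddChar (c * lam p r x + -(c * lam p r y)))).symm
  simp only [h2]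
  rw [sum_comm]
  simp only [hsum]
  rw [← sum_filter, sum_const, nsmul_eq_mul, mul_comm, Nat.card_eq_fintype_card,
    Fintype.card_subtype]

end CharacterSums

/-! ### Quadratic characters and quadratic Gauss sums -/

section QuadraticCharacter

variable (p : ℕ) [Fact p.Prime] {F : Type*} [Field F] [Fintype F] [DecidableEq F]
  [Algebra (ZMod p) F]

/-- Restricting the quadratic character of `F` to the prime field multiplies exponents by
`(q - 1) / (p - 1)`, which has the parity of `n`. -/
theorem quadraticChar_algebraMap (hp : p ≠ 2) {n : ℕ} (hF : Fintype.card F = p ^ n)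
    {c : ZMod p} (hc : c ≠ 0) :
    quadraticChar F (algebraMap (ZMod p) F c) = quadraticChar (ZMod p) c ^ n := by
  have hF2 : ringChar F ≠ 2 := ringChar_ne_two_of_algebra_zmod p hp
  have hp2 : ringChar (ZMod p) ≠ 2 := by rwa [ZMod.ringChar_zmod_n]
  have hodd : Odd p := (Fact.out : p.Prime).odd_of_ne_two hp
  have hc' : algebraMap (ZMod p) F c ≠ 0 := by simpa using hc
  have hexp : p ^ n / 2 = p / 2 * ∑ i ∈ range n, p ^ i := by
    obtain ⟨m, hm⟩ := hodd
    have h1 := Nat.geomSum_eq (m := p) (Fact.out : p.Prime).two_le n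
    have h2 := geom_sum_mul_add (2 * m) n
    rw [← hm] at h2
    have h3 : p / 2 = m := by omega
    rw [h3, ← h2]
    have : (∑ i ∈ range n, p ^ i) * (2 * m) = 2 * (m * ∑ i ∈ range n, p ^ i) := by ring
    omega
  have hpar : (∑ i ∈ range n, p ^ i) % 2 = n % 2 := by
    rw [Finset.sum_nat_mod]
    simp only [Nat.odd_iff.1 hodd.pow, sum_const, card_range, smul_eq_mul, mul_one]
  have hpow : quadraticChar (ZMod p) c ^ n
      = quadraticChar (ZMod p) c ^ ∑ i ∈ range n, p ^ i := by
    have hsq := quadraticChar_sq_one hc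
    have hred (k : ℕ) : quadraticChar (ZMod p) c ^ k = quadraticChar (ZMod p) c ^ (k % 2) := by
      conv_lhs => rw [← Nat.div_add_mod k 2, pow_add, pow_mul, hsq, one_pow, one_mul]
    rw [hred n, hred (∑ i ∈ range n, p ^ i), hpar]
  rw [hpow]
  have hcast : ((quadraticChar F (algebraMap (ZMod p) F c) : ℤ) : F)
      = ((quadraticChar (ZMod p) c ^ ∑ i ∈ range n, p ^ i : ℤ) : F) := by
    rw [quadraticChar_eq_pow_of_char_ne_two' hF2, hF, hexp, pow_mul, ← map_pow]
    have h := quadraticChar_eq_pow_of_char_ne_two' hp2 c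
    rw [ZMod.card] at h
    rw [← h, map_intCast, Int.cast_pow]
  have h1 := quadraticChar_dichotomy hc'
  have h2 : quadraticChar (ZMod p) c ^ (∑ i ∈ range n, p ^ i) = 1 ∨
      quadraticChar (ZMod p) c ^ (∑ i ∈ range n, p ^ i) = -1 := by
    rcases quadraticChar_dichotomy hc with h | h <;> rw [h]
    · left; exact one_pow _
    · exact neg_one_pow_eq_or _ _
  have h1n : (-1 : F) ≠ 1 := Ring.neg_one_ne_one_of_char_ne_two hF2
  rcases h1 with h1 | h1 <;> rcases h2 with h2 | h2 <;> rw [h1, h2] at hcast ⊢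
  · simp only [Int.cast_one, Int.cast_neg] at hcast
    exact absurd hcast.symm h1n
  · simp only [Int.cast_one, Int.cast_neg] at hcast
    exact absurd hcast h1n

/-- The Gauss sum with a shifted additive character. -/
theorem sum_quadraticChar_mul_canonicalAddChar {w : F} (hw : w ≠ 0) :
    ∑ x : F, ((quadraticChar F x : ℤ) : ℂ) * canonicalAddChar p F (w * x)
      = ((quadraticChar F w : ℤ) : ℂ) * quadGauss p F := by
  have hsq : ((quadraticChar F w : ℤ) : ℂ) * ((quadraticChar F w : ℤ) : ℂ) = 1 := by
    rw [← Int.cast_mul, ← sq, quadraticChar_sq_one hw, Int.cast_one]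
  rw [quadGauss, mul_sum]
  refine Fintype.sum_equiv (Equiv.mulLeft₀ w hw) _ _ fun x => ?_
  change _ = _ * (((quadraticChar F (w * x) : ℤ) : ℂ) * canonicalAddChar p F (w * x))
  rw [map_mul (quadraticChar F), Int.cast_mul, ← mul_assoc, ← mul_assoc, hsq, one_mul]

/-- If `x ^ (2 m) = 1` only for `x = ± 1`, the power map `s ↦ s ^ m` permutes the squares, and
so `x ^ (2 m)` and `x ^ 2` are equidistributed. -/
theorem sum_pow_two_mul {M : Type*} [AddCommMonoid M] {m : ℕ} (hm : m ≠ 0)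
    (hker : ∀ x : F, x ^ (2 * m) = 1 → x ^ 2 = 1) (f : F → M) :
    ∑ x : F, f (x ^ (2 * m)) = ∑ x : F, f (x ^ 2) := by
  let T : Finset F := univ.image fun x : F => x ^ 2
  let N (s : F) : ℕ := #{x : F | x ^ 2 = s}
  have hfib (g : F → M) : ∑ x : F, g (x ^ 2) = ∑ s ∈ T, N s • g s := by
    rw [Finset.sum_comp]
  have hmaps : ∀ s ∈ T, s ^ m ∈ T := by
    intro s hs
    obtain ⟨x, -, rfl⟩ := mem_image.1 hs
    exact mem_image.2 ⟨x ^ m, mem_univ _, pow_right_comm _ _ _⟩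
  have hinj : Set.InjOn (fun s : F => s ^ m) T := by
    intro s hs s' hs' h
    obtain ⟨x, -, rfl⟩ := mem_image.1 (mem_coe.1 hs)
    obtain ⟨y, -, rfl⟩ := mem_image.1 (mem_coe.1 hs')
    simp only [← pow_mul] at h
    rcases eq_or_ne y 0 with rfl | hy
    · rw [zero_pow (mul_ne_zero two_ne_zero hm)] at h
      rw [pow_eq_zero_iff (mul_ne_zero two_ne_zero hm)] at h
      rw [h]
    · have := hker (x / y) (by rw [div_pow, h, div_self (pow_ne_zero _ hy)])
      rwa [div_pow, div_eq_one_iff_eq (pow_ne_zero _ hy)] at this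
  have hN : ∀ s ∈ T, N s = N (s ^ m) := by
    -- both fibres are `{0}` when `s = 0`, and cosets of `{x | x ^ 2 = 1}` otherwise
    have hcoset (x : F) (hx : x ≠ 0) : N (x ^ 2) = N 1 := by
      refine (card_equiv (Equiv.mulLeft₀ x hx) fun y => ?_).symm
      simp only [mem_filter, mem_univ, true_and]
      change _ ↔ (x * y) ^ 2 = x ^ 2
      rw [mul_pow]
      exact (mul_eq_left₀ (pow_ne_zero 2 hx)).symm
    intro s hs
    obtain ⟨x, -, rfl⟩ := mem_image.1 hs
    rcases eq_or_ne x 0 with rfl | hx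
    · rw [zero_pow two_ne_zero, zero_pow hm]
    · rw [pow_right_comm, hcoset x hx, hcoset _ (pow_ne_zero m hx)]
  simp only [pow_mul]
  rw [hfib fun s => f (s ^ m), hfib]
  refine sum_bij (fun s _ => s ^ m) hmaps (fun s hs s' hs' h => hinj hs hs' h) ?_ ?_
  · intro s hs
    obtain ⟨s', hs', h⟩ := surj_on_of_inj_on_of_card_le (fun s _ => s ^ m) hmaps
      (fun _ _ hs hs' h => hinj hs hs' h) le_rfl s hs
    exact ⟨s', hs', h.symm⟩
  · intro s hs
    rw [hN s hs]

/-- The quadratic Gauss sum as a sum over squares. -/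
theorem sum_canonicalAddChar_mul_sq (hp : p ≠ 2) {w : F} (hw : w ≠ 0) :
    ∑ x : F, canonicalAddChar p F (w * x ^ 2) = ((quadraticChar F w : ℤ) : ℂ) * quadGauss p F := by
  have hF2 : ringChar F ≠ 2 := ringChar_ne_two_of_algebra_zmod p hp
  have hfib : ∑ x : F, canonicalAddChar p F (w * x ^ 2)
      = ∑ s : F, (((quadraticChar F s + 1 : ℤ)) : ℂ) * canonicalAddChar p F (w * s) := by
    rw [← sum_fiberwise_of_maps_to (s := univ) (t := univ) (g := fun x : F => x ^ 2)
      fun _ _ => mem_univ _]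
    refine sum_congr rfl fun s _ => ?_
    rw [sum_congr rfl fun x hx => by rw [(mem_filter.1 hx).2], sum_const, nsmul_eq_mul,
      ← quadraticChar_card_sqrts hF2 s, Int.cast_natCast]
    congr 3
    ext x
    simp
  rw [hfib, ← sum_quadraticChar_mul_canonicalAddChar p hw]
  simp only [Int.cast_add, Int.cast_one, add_mul, one_mul, sum_add_distrib]
  rw [sum_canonicalAddChar_mul, if_neg hw, add_zero]

end QuadraticCharacter

/-! ### Arithmetic of the exponents -/

section Exponents

theorem gcd_dvd_of_odd_div_gcd {n r : ℕ} (hn : 0 < n) (h : Odd (n / n.gcd r)) (k : ℕ) :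
    n.gcd (2 ^ k * r) ∣ n.gcd r := by
  have hv : 0 < n.gcd r := Nat.gcd_pos_of_pos_left r hn
  obtain ⟨n', hn'⟩ := Nat.gcd_dvd_left n r
  obtain ⟨r', hr'⟩ := Nat.gcd_dvd_right n r
  have hco := Nat.coprime_div_gcd_div_gcd hv
  generalize n.gcd r = v at *
  subst hn' hr'
  rw [Nat.mul_div_cancel_left _ hv] at h hco
  rw [Nat.mul_div_cancel_left _ hv] at hco
  have h2 : Nat.Coprime n' (2 ^ k * r') :=
    Nat.Coprime.mul_right (Nat.Coprime.pow_right k h.coprime_two_right) hco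
  rw [mul_left_comm, Nat.gcd_mul_left, h2.gcd_eq_one, mul_one]

/-- The shape of `n` and `r` when `n / gcd(n, r)` is even. -/
theorem exists_eq_mul_of_even_div_gcd {n r : ℕ} (hn : 0 < n) (h : Even (n / n.gcd r)) :
    ∃ m s : ℕ, n = 2 * n.gcd r * m ∧ r = n.gcd r * s ∧ Odd s ∧ Nat.Coprime m s := by
  have hv : 0 < n.gcd r := Nat.gcd_pos_of_pos_left r hn
  obtain ⟨n', hn'⟩ := Nat.gcd_dvd_left n r
  obtain ⟨s, hs⟩ := Nat.gcd_dvd_right n r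
  have hco := Nat.coprime_div_gcd_div_gcd hv
  have h1 : n / n.gcd r = n' := Nat.div_eq_of_eq_mul_right hv hn'
  have h2 : r / n.gcd r = s := Nat.div_eq_of_eq_mul_right hv hs
  rw [h1] at h
  rw [h1, h2] at hco
  obtain ⟨m, rfl⟩ := h.two_dvd
  refine ⟨m, s, by rw [mul_comm 2, mul_assoc]; exact hn', hs, ?_, hco.coprime_mul_left⟩
  exact Nat.coprime_two_left.1 hco.coprime_mul_right

theorem pow_add_one_dvd_pow_mul_add_one (p v : ℕ) {m : ℕ} (hm : Odd m) :
    p ^ v + 1 ∣ p ^ (v * m) + 1 := by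
  simpa only [pow_mul, one_pow] using hm.nat_add_dvd_pow_add_pow (p ^ v) 1

theorem modEq_of_odd_mul (v : ℕ) {s : ℕ} (hs : Odd s) : v * s ≡ v [MOD 2 * v] := by
  obtain ⟨k, rfl⟩ := hs
  rw [show v * (2 * k + 1) = v + 2 * v * k by ring]
  exact Nat.add_modulus_mul_modEq_iff.2 rfl

end Exponents

/-! ### Powers and cosets in finite groups -/

section CyclicGroups

/-- In a finite cyclic group of order divisible by `d * e`, the `e`-torsion consists of `d`-th
powers. -/
theorem IsCyclic.exists_pow_eq_of_pow_eq_one {G : Type*} [Group G] [Finite G] [IsCyclic G]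
    {d e : ℕ} (he : 0 < e) (hde : d * e ∣ Nat.card G) {c : G} (hc : c ^ e = 1) :
    ∃ w : G, w ^ d = c := by
  obtain ⟨g, hg⟩ := IsCyclic.exists_generator (α := G)
  obtain ⟨j, rfl⟩ := Submonoid.mem_powers_iff _ _ |>.1 (mem_powers_iff_mem_zpowers.2 (hg c))
  rw [← pow_mul, ← orderOf_dvd_iff_pow_eq_one, orderOf_eq_card_of_forall_mem_zpowers hg] at hc
  obtain ⟨k, rfl⟩ := Nat.dvd_of_mul_dvd_mul_right he (hde.trans hc)
  exact ⟨g ^ k, by rw [← pow_mul, mul_comm]⟩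

theorem Subgroup.card_dvd_card_of_mul_mem {G : Type*} [Group G] (H : Subgroup G) {A : Set G}
    (hA : ∀ a ∈ A, ∀ h ∈ H, a * h ∈ A) : Nat.card H ∣ Nat.card A := by
  let f : G → G ⧸ H := QuotientGroup.mk
  have hpre : f ⁻¹' (f '' A) = A := by
    refine Set.Subset.antisymm ?_ (Set.subset_preimage_image _ _)
    rintro x ⟨a, ha, hax⟩
    have := hA a ha _ (QuotientGroup.eq.1 hax)
    rwa [mul_inv_cancel_left] at this
  have hcard := Nat.card_congr (QuotientGroup.preimageMkEquivSubgroupProdSet H (f '' A))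
  rw [Nat.card_prod] at hcard
  exact ⟨_, by rw [← hcard]; exact congrArg (fun B : Set G => Nat.card B) hpre.symm⟩

end CyclicGroups

/-! ### The size of the radical -/

section Radical

variable (p : ℕ) [Fact p.Prime] {F : Type*} [Field F] [Fintype F] [Algebra (ZMod p) F]

omit [Fact p.Prime] [Algebra (ZMod p) F] in
theorem pow_prime_pow_eq_self {n : ℕ} (hF : Fintype.card F = p ^ n) (x : F) :
    x ^ (p ^ n) = x := by
  rw [← hF, FiniteField.pow_card]

theorem pow_prime_pow_two_mul_of_add_eq_zero {k : ℕ} {x : F} (hx : x ^ (p ^ k) + x = 0) :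
    x ^ (p ^ (2 * k)) = x := by
  have h := eq_neg_of_add_eq_zero_left hx
  rw [two_mul, pow_add, pow_mul, h, neg_pow_prime_pow, h, neg_neg]

/-- The radical is trivial when `gcd(n, 4 r)` divides `2 r`: its elements lie in the subfield of
degree `gcd(n, 4 r)`, where `x ^ (p ^ (2 r)) = x`. -/
theorem eq_zero_of_mem_radical (hp : p ≠ 2) {n r : ℕ} (hF : Fintype.card F = p ^ n)
    (h : n.gcd (4 * r) ∣ 2 * r) {x : F} (hx : x ^ (p ^ (2 * r)) + x = 0) : x = 0 := by
  have h4 := pow_prime_pow_two_mul_of_add_eq_zero p hx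
  rw [show 2 * (2 * r) = 4 * r by ring] at h4
  have h2 := pow_prime_pow_of_dvd (pow_prime_pow_gcd (pow_prime_pow_eq_self p hF x) h4) h
  rw [h2, ← two_mul] at hx
  exact (mul_eq_zero.1 hx).resolve_left (two_ne_zero_of_algebra_zmod p hp)

theorem exists_isGamma_of_radical_trivial {r : ℕ}
    (h : ∀ x : F, x ^ (p ^ (2 * r)) + x = 0 → x = 0) (a : F) : ∃ γ : F, IsGamma p r a γ := by
  rcases exists_isGamma_or_exists_trace_ne_zero p r a with h' | ⟨k, hk, hak⟩
  · exact h'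
  · rw [h k hk, mul_zero, map_zero] at hak
    exact absurd rfl hak

omit [Fintype F] [Algebra (ZMod p) F] in
theorem card_radical_of_trivial {r : ℕ}
    (h : ∀ x : F, x ^ (p ^ (2 * r)) + x = 0 → x = 0) :
    Nat.card {x : F // x ^ (p ^ (2 * r)) + x = 0} = 1 := by
  rw [Nat.card_eq_one_iff_unique]
  refine ⟨⟨fun x y => Subtype.ext ((h _ x.2).trans (h _ y.2).symm)⟩, ⟨⟨0, ?_⟩⟩⟩
  rw [zero_pow (pow_ne_zero _ (Fact.out : p.Prime).ne_zero), add_zero]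

omit [Algebra (ZMod p) F] in
/-- The nonzero solutions of `x ^ (p ^ k) = -x` form a coset of the group of roots of unity of
order dividing `p ^ k - 1`. -/
theorem card_pow_prime_pow_add_eq_zero (hp : p ≠ 2) {n k : ℕ} (hF : Fintype.card F = p ^ n)
    (hkn : 2 * k ∣ n) :
    Nat.card {x : F // x ^ (p ^ k) + x = 0} = p ^ k := by
  classical
  have hpk : 1 ≤ p ^ k := Nat.one_le_pow _ _ (Fact.out : p.Prime).pos
  have hodd : Odd p := (Fact.out : p.Prime).odd_of_ne_two hp
  have hcard : Nat.card Fˣ = p ^ n - 1 := by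
    rw [Nat.card_eq_fintype_card, Fintype.card_units, hF]
  have hdvd : (p ^ k - 1) * 2 ∣ Nat.card Fˣ := by
    rw [hcard]
    have h1 : p ^ (2 * k) - 1 = (p ^ k - 1) * (p ^ k + 1) := by
      rw [mul_comm 2, pow_mul, mul_comm]
      simpa using Nat.sq_sub_sq (p ^ k) 1
    refine (mul_dvd_mul_left _ ?_).trans (h1 ▸ Nat.pow_sub_one_dvd_pow_sub_one p hkn)
    exact (hodd.pow.add_one).two_dvd
  obtain ⟨w, hw⟩ := IsCyclic.exists_pow_eq_of_pow_eq_one two_pos hdvd (neg_one_sq (R := Fˣ))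
  have hset : (univ.filter fun x : F => x ^ (p ^ k) + x = 0)
      = insert 0 ((univ.filter fun u : Fˣ => u ^ (p ^ k - 1) = 1).image
          fun u => ((w * u : Fˣ) : F)) := by
    ext x
    have hpow : x ^ (p ^ k) + x = x * (x ^ (p ^ k - 1) + 1) := by
      rw [mul_add, mul_one, ← pow_succ', Nat.sub_add_cancel hpk]
    simp only [mem_filter, mem_univ, true_and, mem_insert, mem_image]
    constructor
    · intro hx
      rw [hpow, mul_eq_zero] at hx
      rcases eq_or_ne x 0 with h0 | h0
      · exact Or.inl h0
      · refine Or.inr ⟨w⁻¹ * Units.mk0 x h0, ?_, by simp⟩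
        have hx1 : Units.mk0 x h0 ^ (p ^ k - 1) = -1 := by
          ext
          simpa using eq_neg_of_add_eq_zero_left (hx.resolve_left h0)
        rw [mul_pow, inv_pow, hw, hx1]
        simp
    · rintro (rfl | ⟨u, hu, rfl⟩)
      · rw [zero_pow (by omega), add_zero]
      · rw [hpow, ← Units.val_pow_eq_pow_val, mul_pow, hw, hu]
        simp
  rw [Nat.card_eq_fintype_card, Fintype.card_subtype, hset, card_insert_of_notMem,
    card_image_of_injective]
  · have := IsCyclic.card_powMonoidHom_ker (G := Fˣ) (p ^ k - 1)
    rw [Nat.gcd_eq_right ((Dvd.intro _ rfl).trans hdvd), Nat.card_eq_fintype_card,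
      Fintype.card_subtype] at this
    simp only [MonoidHom.mem_ker, powMonoidHom_apply] at this
    rw [this, Nat.sub_add_cancel hpk]
  · exact fun u u' h => mul_left_cancel (Units.ext h)
  · simp

/-- When `2 r ≡ 2 v` modulo `4 v` and `gcd(n, 4 r)` divides `4 v`, the radical is the solution set
of `x ^ (p ^ (2 v)) = -x`. -/
theorem card_radical (hp : p ≠ 2) {n r v : ℕ} (hF : Fintype.card F = p ^ n)
    (hvn : 4 * v ∣ n) (hgcd : n.gcd (4 * r) ∣ 4 * v) (hr : 2 * r ≡ 2 * v [MOD 4 * v]) :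
    Nat.card {x : F // x ^ (p ^ (2 * r)) + x = 0} = p ^ (2 * v) := by
  rw [← card_pow_prime_pow_add_eq_zero p hp hF (k := 2 * v) (by rwa [← mul_assoc])]
  refine Nat.card_congr (Equiv.subtypeEquivRight fun x => ?_)
  constructor
  · intro hx
    have h4 := pow_prime_pow_two_mul_of_add_eq_zero p hx
    rw [show 2 * (2 * r) = 4 * r by ring] at h4
    have h4v := pow_prime_pow_of_dvd (pow_prime_pow_gcd (pow_prime_pow_eq_self p hF x) h4) hgcd
    rwa [← pow_prime_pow_congr h4v hr]
  · intro hx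
    have h4v := pow_prime_pow_two_mul_of_add_eq_zero p hx
    rw [show 2 * (2 * v) = 4 * v by ring] at h4v
    rwa [pow_prime_pow_congr h4v hr]

end Radical

/-! ### Weil sums when `n / gcd(n, r)` is odd -/

section OddQuotient

variable (p : ℕ) [Fact p.Prime] {F : Type*} [Field F] [Fintype F] [DecidableEq F]
  [Algebra (ZMod p) F]

/-- When `n / gcd(n, r)` is odd, `x ^ (p ^ r + 1)` and `x ^ 2` are equidistributed and the Weil
sum is a quadratic Gauss sum. -/
theorem weilSum_of_odd_div_gcd (hp : p ≠ 2) {n r : ℕ} (hn : 0 < n) (hF : Fintype.card F = p ^ n)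
    (hodd : Odd (n / n.gcd r)) {c : ZMod p} (hc : c ≠ 0) :
    weilSum p r F c = ((quadraticChar (ZMod p) c ^ n : ℤ) : ℂ) * quadGauss p F := by
  have hc' : algebraMap (ZMod p) F c ≠ 0 := by simpa using hc
  obtain ⟨m, hm⟩ := (((Fact.out : p.Prime).odd_of_ne_two hp).pow (n := r)).add_one.two_dvd
  have hker (x : F) (hx : x ^ (2 * m) = 1) : x ^ 2 = 1 := by
    rw [← hm] at hx
    have hx0 : x ≠ 0 := by
      rintro rfl
      rw [zero_pow (Nat.add_one_ne_zero _)] at hx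
      exact zero_ne_one hx
    rw [pow_succ] at hx
    have h2r : x ^ (p ^ (2 * r)) = x := by
      rw [two_mul, pow_add, pow_mul, eq_inv_of_mul_eq_one_left hx, inv_pow,
        eq_inv_of_mul_eq_one_left hx, inv_inv]
    have hv := pow_prime_pow_of_dvd (pow_prime_pow_gcd (pow_prime_pow_eq_self p hF x) h2r)
      ((by simpa using gcd_dvd_of_odd_div_gcd hn hodd 1 : n.gcd (2 * r) ∣ n.gcd r).trans
        (Nat.gcd_dvd_right n r))
    rw [hv] at hx
    rw [sq, hx]
  have hm0 : m ≠ 0 := by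
    rintro rfl
    omega
  rw [← quadraticChar_algebraMap p hp hF hc, ← sum_canonicalAddChar_mul_sq p hp hc', ←
    sum_pow_two_mul hm0 hker fun z => canonicalAddChar p F (algebraMap (ZMod p) F c * z), ← hm]
  refine sum_congr rfl fun x _ => ?_
  rw [canonicalAddChar_apply, ← Algebra.smul_def, map_smul, smul_eq_mul, lam]

theorem canonicalAddChar_zmod (x : ZMod p) :
    canonicalAddChar p (ZMod p) x = ZMod.stdAddChar x := by
  rw [canonicalAddChar_apply]
  congr 1
  exact Algebra.trace_self_apply x

theorem traceCount_zero_of_odd (hp : p ≠ 2) {n r : ℕ} (hF : Fintype.card F = p ^ n)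
    (hn : Odd n) (b : ZMod p) :
    (traceCount p r (0 : F) b : ℂ) = (p : ℂ) ^ (n - 1)
      + (p : ℂ)⁻¹ * quadGauss p F * quadGauss p (ZMod p)
        * ((quadraticChar (ZMod p) b : ℤ) : ℂ) := by
  have hp0 : (p : ℂ) ≠ 0 := Nat.cast_ne_zero.2 (Fact.out : p.Prime).ne_zero
  have hpn : (p : ℂ) ^ n = p * (p : ℂ) ^ (n - 1) := by
    rw [← pow_succ', Nat.sub_add_cancel hn.pos]
  have hv : Odd (n / n.gcd r) :=
    Odd.of_dvd_nat hn (Nat.div_dvd_of_dvd (Nat.gcd_dvd_left n r))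
  have hS (y : ZMod p) (hy : y ≠ 0) :
      weilSum p r F y = ((quadraticChar (ZMod p) y : ℤ) : ℂ) * quadGauss p F := by
    rw [weilSum_of_odd_div_gcd p hp hn.pos hF hv hy]
    obtain ⟨k, rfl⟩ := hn
    rw [pow_succ, pow_mul, quadraticChar_sq_one hy, one_pow, one_mul]
  have hG : ∑ y : ZMod p, ((quadraticChar (ZMod p) y : ℤ) : ℂ) * ZMod.stdAddChar (b * y)
      = ((quadraticChar (ZMod p) b : ℤ) : ℂ) * quadGauss p (ZMod p) := by
    rcases eq_or_ne b 0 with rfl | hb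
    · simp only [zero_mul, AddChar.map_zero_eq_one, mul_one]
      rw [← Int.cast_sum, quadraticChar_sum_zero (by rwa [ZMod.ringChar_zmod_n])]
      simp
    · rw [← sum_quadraticChar_mul_canonicalAddChar p hb]
      simp only [canonicalAddChar_zmod]
  refine mul_left_cancel₀ hp0 ?_
  rw [mul_traceCount_zero, ← add_sum_erase _ _ (mem_univ (0 : ZMod p))]
  rw [← add_sum_erase _ _ (mem_univ (0 : ZMod p))] at hG
  rw [sum_congr rfl fun y hy => by
    rw [hS y (mem_erase.1 hy).1, ← mul_assoc, mul_comm y b, mul_comm (ZMod.stdAddChar (b * y))],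
    ← sum_mul, weilSum_zero, hF]
  simp only [zero_mul, mul_zero, AddChar.map_zero_eq_one, Nat.cast_pow, hpn, one_mul,
    quadraticChar_zero, Int.cast_zero, zero_add] at hG ⊢
  rw [hG]
  field_simp

end OddQuotient

/-! ### Weil sums when `n / gcd(n, r)` is even -/

section EvenQuotient

variable (p : ℕ) [Fact p.Prime] {F : Type*} [Field F] [Fintype F] [Algebra (ZMod p) F]

omit [Fact p.Prime] [Algebra (ZMod p) F] in
theorem pow_succ_mul_pred_dvd_card_units {n v : ℕ} (hF : Fintype.card F = p ^ n)
    (hvn : 2 * v ∣ n) : (p ^ v + 1) * (p - 1) ∣ Nat.card Fˣ := by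
  classical
  have h1 : p ^ (2 * v) - 1 = (p ^ v + 1) * (p ^ v - 1) := by
    rw [mul_comm 2, pow_mul]
    simpa using Nat.sq_sub_sq (p ^ v) 1
  rw [Nat.card_eq_fintype_card, Fintype.card_units, hF]
  refine (mul_dvd_mul_left _ ?_).trans (h1 ▸ Nat.pow_sub_one_dvd_pow_sub_one p hvn)
  simpa using Nat.pow_sub_one_dvd_pow_sub_one p (one_dvd v)

/-- If `w ^ (p ^ v + 1)` lies in the prime field, then `w` lies in the subfield of degree `2 v`,
on which `w ^ (p ^ r) = w ^ (p ^ v)` for `r ≡ v` modulo `2 v`. -/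
theorem pow_prime_pow_succ_congr {r v : ℕ} (hrv : r ≡ v [MOD 2 * v]) {w : F} {c : ZMod p}
    (hc : c ≠ 0) (hw : w ^ (p ^ v + 1) = algebraMap (ZMod p) F c) :
    w ^ (p ^ r + 1) = algebraMap (ZMod p) F c := by
  have hw0 : w ^ (p ^ v) ≠ 0 := by
    intro h
    rw [pow_succ, h, zero_mul] at hw
    exact hc (by simpa using hw.symm)
  have h2 : w ^ (p ^ (2 * v)) = w := by
    have h := congrArg (· ^ (p ^ v)) hw
    simp only [pow_succ, mul_pow, algebraMap_pow_prime_pow] at h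
    rw [← hw, pow_succ, ← pow_mul, ← pow_add p, ← two_mul, mul_comm (w ^ p ^ v)] at h
    exact mul_right_cancel₀ hw0 h
  rw [← hw, pow_succ, pow_succ, pow_prime_pow_congr h2 hrv]

/-- Every scalar of the prime field is a norm from the subfield of degree `2 v`, so rescaling the
form does not change its Weil sum. -/
theorem weilSum_eq_weilSum_one {n r v : ℕ} (hF : Fintype.card F = p ^ n)
    (hvn : 2 * v ∣ n) (hrv : r ≡ v [MOD 2 * v]) {c : ZMod p} (hc : c ≠ 0) :
    weilSum p r F c = weilSum p r F 1 := by
  have hc' : algebraMap (ZMod p) F c ≠ 0 := by simpa using hc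
  have hpow : Units.mk0 _ hc' ^ (p - 1) = 1 := by
    ext
    rw [Units.val_pow_eq_pow_val, Units.val_mk0, ← map_pow, ZMod.pow_card_sub_one_eq_one hc,
      map_one, Units.val_one]
  obtain ⟨w, hw⟩ := IsCyclic.exists_pow_eq_of_pow_eq_one
    (Nat.sub_pos_of_lt (Fact.out : p.Prime).one_lt)
    (pow_succ_mul_pred_dvd_card_units p hF hvn) hpow
  have hwc : (w : F) ^ (p ^ r + 1) = algebraMap (ZMod p) F c := by
    refine pow_prime_pow_succ_congr p hrv hc ?_
    rw [← Units.val_pow_eq_pow_val, hw, Units.val_mk0]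
  unfold weilSum
  rw [← (Units.mulLeft_bijective w).sum_comp fun x => ZMod.stdAddChar (1 * lam p r x)]
  refine sum_congr rfl fun x _ => ?_
  rw [lam, lam, mul_pow, hwc, ← Algebra.smul_def, map_smul, smul_eq_mul, one_mul]

/-- The group of roots of unity of order dividing `p ^ v + 1` acts freely on the solutions of
`Tr(x ^ (p ^ r + 1)) = -b` for `b ≠ 0`. -/
theorem pow_succ_dvd_traceCount_zero {n r v : ℕ} (hF : Fintype.card F = p ^ n)
    (hvn : 2 * v ∣ n) (hrv : r ≡ v [MOD 2 * v]) {b : ZMod p} (hb : b ≠ 0) :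
    p ^ v + 1 ∣ traceCount p r (0 : F) b := by
  let A : Set Fˣ := {u | Algebra.trace (ZMod p) F (0 * u - (u : F) ^ (p ^ r + 1)) = b}
  have hA : Nat.card A = traceCount p r (0 : F) b := by
    refine Nat.card_congr (Equiv.ofBijective (fun u => ⟨(u.1 : F), u.2⟩) ⟨?_, ?_⟩)
    · intro u u' h
      exact Subtype.ext (Units.ext (congrArg Subtype.val h))
    · rintro ⟨x, hx⟩
      have hx0 : x ≠ 0 := by
        rintro rfl
        rw [zero_pow (Nat.add_one_ne_zero _), mul_zero, sub_zero, map_zero] at hx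
        exact hb hx.symm
      exact ⟨⟨Units.mk0 x hx0, hx⟩, rfl⟩
  have hH := IsCyclic.card_powMonoidHom_ker (G := Fˣ) (p ^ v + 1)
  rw [Nat.gcd_eq_right ((Dvd.intro _ rfl).trans (pow_succ_mul_pred_dvd_card_units p hF hvn))] at hH
  rw [← hA, ← hH]
  refine Subgroup.card_dvd_card_of_mul_mem _ fun u hu h hh => ?_
  -- elements of norm `1` to the subfield of degree `v` do not change `x ^ (p ^ r + 1)`
  have h1 : (h : F) ^ (p ^ r + 1) = 1 := by
    rw [← map_one (algebraMap (ZMod p) F)]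
    refine pow_prime_pow_succ_congr p hrv one_ne_zero ?_
    rw [MonoidHom.mem_ker, powMonoidHom_apply] at hh
    rw [← Units.val_pow_eq_pow_val, hh, Units.val_one, map_one]
  change Algebra.trace (ZMod p) F _ = b
  rw [Units.val_mul, mul_pow, h1, mul_one, zero_mul]
  have hu' : Algebra.trace (ZMod p) F (0 * u - (u : F) ^ (p ^ r + 1)) = b := hu
  rwa [zero_mul] at hu'

/-- The Weil sum is an integer congruent to `1` modulo `p ^ v + 1`, and this congruence
determines its sign once its absolute value `p ^ w` is known. -/
theorem weilSum_eq_neg_pow (hp : p ≠ 2) {n r v w : ℕ} (hn : 0 < n) (hv : 0 < v)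
    (hF : Fintype.card F = p ^ n) (hvn : 2 * v ∣ n) (hrv : r ≡ v [MOD 2 * v])
    (hw : p ^ v + 1 ∣ p ^ w + 1)
    (hrad : p ^ n * Nat.card {x : F // x ^ (p ^ (2 * r)) + x = 0} = (p ^ w) ^ 2)
    {c : ZMod p} (hc : c ≠ 0) : weilSum p r F c = -(p : ℂ) ^ w := by
  have hp0 : (p : ℂ) ≠ 0 := Nat.cast_ne_zero.2 (Fact.out : p.Prime).ne_zero
  rw [weilSum_eq_weilSum_one p hF hvn hrv hc]
  have hN := traceCount_zero_of_weilSum_const p hn hF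
    (fun y hy => weilSum_eq_weilSum_one p hF hvn hrv hy) (1 : ZMod p)
  obtain ⟨z, hz⟩ : ∃ z : ℤ, z = (p : ℤ) ^ n - p * traceCount p r (0 : F) (1 : ZMod p) := ⟨_, rfl⟩
  have hS : weilSum p r F 1 = z := by
    have hpn : (p : ℂ) ^ n = p * (p : ℂ) ^ (n - 1) := by
      rw [← pow_succ', Nat.sub_add_cancel hn]
    rw [if_neg one_ne_zero] at hN
    rw [hz]
    push_cast
    rw [hN, hpn]
    field_simp
    ring
  have hsq : z ^ 2 = ((p : ℤ) ^ w) ^ 2 := by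
    have h := weilSum_mul_conj p hp r (F := F) (one_ne_zero (α := ZMod p))
    rw [hS, map_intCast, hF, ← sq] at h
    have h' : z ^ 2 = ((p ^ n * Nat.card {x : F // x ^ (p ^ (2 * r)) + x = 0} : ℕ) : ℤ) := by
      exact_mod_cast h
    rw [h', hrad]
    push_cast
    rfl
  have hz1 : ((p ^ v + 1 : ℕ) : ℤ) ∣ z - 1 := by
    have h1 : p ^ v + 1 ∣ p ^ n - 1 := by
      have := (Dvd.intro _ rfl).trans (pow_succ_mul_pred_dvd_card_units p hF hvn)
      classical
      rwa [Nat.card_eq_fintype_card, Fintype.card_units, hF] at this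
    have h1' : ((p ^ v + 1 : ℕ) : ℤ) ∣ (p : ℤ) ^ n - 1 := by
      have := Int.natCast_dvd_natCast.2 h1
      rwa [Nat.cast_sub (Nat.one_le_pow _ _ (Fact.out : p.Prime).pos), Nat.cast_pow,
        Nat.cast_one] at this
    have h2 := Int.natCast_dvd_natCast.2
      (pow_succ_dvd_traceCount_zero p hF hvn hrv (one_ne_zero (α := ZMod p)))
    rw [hz, sub_right_comm]
    exact dvd_sub h1' (h2.mul_left _)
  rw [hS]
  rcases sq_eq_sq_iff_eq_or_eq_neg.1 hsq with h | h
  -- `z = p ^ w` would give `p ^ v + 1 ∣ 2`, from `z ≡ 1` and `p ^ w ≡ -1`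
  · exfalso
    rw [h] at hz1
    have h2 : ((p ^ v + 1 : ℕ) : ℤ) ∣ (p : ℤ) ^ w + 1 := by exact_mod_cast hw
    have h3 : ((p ^ v + 1 : ℕ) : ℤ) ∣ (2 : ℕ) := by
      have := dvd_sub h2 hz1
      rwa [show (p : ℤ) ^ w + 1 - ((p : ℤ) ^ w - 1) = (2 : ℕ) by push_cast; ring] at this
    have h4 := Nat.le_of_dvd two_pos (Int.natCast_dvd_natCast.1 h3)
    have h5 : p ≤ p ^ v :=
      (pow_one p).symm.trans_le <| Nat.pow_le_pow_right (Fact.out : p.Prime).pos hv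
    have := (Fact.out : p.Prime).two_le
    omega
  · rw [h]
    push_cast
    rfl

theorem traceCount_zero_of_weilSum_eq_neg_pow {n r w : ℕ} (hn : 0 < n) (hw : 0 < w)
    (hF : Fintype.card F = p ^ n)
    (hS : ∀ y : ZMod p, y ≠ 0 → weilSum p r F y = -(p : ℂ) ^ w) (b : ZMod p) :
    (traceCount p r (0 : F) b : ℤ) = (p : ℤ) ^ (n - 1)
      - ((if b = 0 then (p : ℤ) else 0) - 1) * (p : ℤ) ^ (w - 1) := by
  have hp0 : (p : ℂ) ≠ 0 := Nat.cast_ne_zero.2 (Fact.out : p.Prime).ne_zero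
  have hpw : (p : ℂ) ^ w = p * (p : ℂ) ^ (w - 1) := by
    rw [← pow_succ', Nat.sub_add_cancel hw]
  have h := traceCount_zero_of_weilSum_const p hn hF hS b
  rw [hpw] at h
  have h' : (traceCount p r (0 : F) b : ℂ) = (p : ℂ) ^ (n - 1)
      - ((if b = 0 then (p : ℂ) else 0) - 1) * (p : ℂ) ^ (w - 1) := by
    rw [h]
    field_simp
    ring
  split_ifs at h' ⊢ <;> exact_mod_cast h'

end EvenQuotient

/-! ### Counts when `n / gcd(n, r)` is even -/

section EvenQuotientCounts

variable (p : ℕ) [Fact p.Prime] {F : Type*} [Field F] [Fintype F] [Algebra (ZMod p) F]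

theorem radical_trivial_of_odd_div_gcd (hp : p ≠ 2) {n r : ℕ} (hn : 0 < n)
    (hF : Fintype.card F = p ^ n) (hodd : Odd (n / n.gcd r)) (x : F)
    (hx : x ^ (p ^ (2 * r)) + x = 0) : x = 0 := by
  have h := (gcd_dvd_of_odd_div_gcd hn hodd 2).trans (Nat.gcd_dvd_right n r)
  exact eq_zero_of_mem_radical p hp hF (h.mul_left 2) hx

theorem radical_trivial_of_odd (hp : p ≠ 2) {v m s : ℕ}
    (hF : Fintype.card F = p ^ (2 * v * m)) (hm : Odd m) (hms : m.Coprime s) (x : F)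
    (hx : x ^ (p ^ (2 * (v * s))) + x = 0) : x = 0 := by
  refine eq_zero_of_mem_radical p hp hF ?_ hx
  rw [show 4 * (v * s) = 2 * v * (2 * s) by ring, Nat.gcd_mul_left,
    (Nat.Coprime.mul_right hm.coprime_two_right hms).gcd_eq_one, mul_one]
  exact ⟨s, by ring⟩

theorem traceCount_zero_of_trivial_radical (hp : p ≠ 2) {v m s : ℕ} (hv : 0 < v) (hs : Odd s)
    (hF : Fintype.card F = p ^ (2 * v * m)) (hm : Odd m) (hms : m.Coprime s) (b : ZMod p) :
    (traceCount p (v * s) (0 : F) b : ℤ) = (p : ℤ) ^ (2 * v * m - 1)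
      - ((if b = 0 then (p : ℤ) else 0) - 1) * (p : ℤ) ^ (v * m - 1) := by
  have hvm : 0 < v * m := mul_pos hv hm.pos
  have hn : 0 < 2 * v * m := by rw [mul_assoc]; exact mul_pos two_pos hvm
  refine traceCount_zero_of_weilSum_eq_neg_pow p hn hvm hF (fun y hy => ?_) b
  refine weilSum_eq_neg_pow p hp hn hv hF (Dvd.intro _ rfl) (modEq_of_odd_mul v hs)
    (pow_add_one_dvd_pow_mul_add_one p v hm) ?_ hy
  rw [card_radical_of_trivial p (radical_trivial_of_odd p hp hF hm hms), mul_one, ← pow_mul]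
  congr 1
  ring

theorem traceCount_zero_of_nontrivial_radical (hp : p ≠ 2) {v m s : ℕ} (hv : 0 < v) (hs : Odd s)
    (hm0 : 0 < m) (hF : Fintype.card F = p ^ (2 * v * m)) (hm : Even m) (hms : m.Coprime s)
    (b : ZMod p) :
    (traceCount p (v * s) (0 : F) b : ℤ) = (p : ℤ) ^ (2 * v * m - 1)
      - ((if b = 0 then (p : ℤ) else 0) - 1) * (p : ℤ) ^ (v * m + v - 1) := by
  have hvm : 0 < v * m := mul_pos hv hm0
  have hn : 0 < 2 * v * m := by rw [mul_assoc]; exact mul_pos two_pos hvm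
  refine traceCount_zero_of_weilSum_eq_neg_pow p hn (by omega) hF (fun y hy => ?_) b
  refine weilSum_eq_neg_pow p hp hn hv hF (Dvd.intro _ rfl) (modEq_of_odd_mul v hs)
    (pow_add_one_dvd_pow_mul_add_one p v hm.add_one) ?_ hy
  rw [card_radical p hp (v := v) hF, ← pow_mul, ← pow_add]
  · congr 1
    ring
  · obtain ⟨k, rfl⟩ := hm.two_dvd
    exact ⟨k, by ring⟩
  · rw [show 4 * (v * s) = 2 * v * 2 * s by ring, show 4 * v = 2 * v * 2 by ring, mul_assoc _ 2,
      Nat.gcd_mul_left, hms.symm.gcd_mul_right_cancel_right]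
    exact mul_dvd_mul_left _ (Nat.gcd_dvd_right m 2)
  · have := (modEq_of_odd_mul v hs).mul_left' 2
    rwa [← mul_assoc 2 2 v] at this

end EvenQuotientCounts

/-! ### Evaluation of the counts -/

theorem lemma10 (p : ℕ) [Fact p.Prime] (hp : p ≠ 2) (n r v t : ℕ) (hn : 0 < n) (hr : 0 < r)
    (hv : v = Nat.gcd n r) (ht : t = n / 2)
    (F : Type*) [Field F] [Fintype F] [DecidableEq F] [Algebra (ZMod p) F]
    (hF : Fintype.card F = p ^ n) (a : F) (b : ZMod p) :
    -- (1)
    (Odd n →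
      (a = 0 → b = 0 → traceCount p r a b = p ^ (n - 1)) ∧
      (a = 0 → b ≠ 0 → (traceCount p r a b : ℂ) = (p : ℂ) ^ (n - 1)
        + (p : ℂ)⁻¹ * quadGauss p F * quadGauss p (ZMod p)
          * ((quadraticChar (ZMod p) b : ℤ) : ℂ)) ∧
      (a ≠ 0 → (∃ γ : F, IsGamma p r a γ) ∧ ∀ γ : F, IsGamma p r a γ →
        (lam p r γ = b → traceCount p r a b = p ^ (n - 1)) ∧
        (lam p r γ ≠ b → (traceCount p r a b : ℂ) = (p : ℂ) ^ (n - 1)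
          + (p : ℂ)⁻¹ * quadGauss p F * quadGauss p (ZMod p)
            * ((quadraticChar (ZMod p) (b - lam p r γ) : ℤ) : ℂ)))) ∧
    -- (2)
    (Even n → Odd (n / v) →
      (a = 0 → b = 0 → (traceCount p r a b : ℂ) = (p : ℂ) ^ (n - 1)
        + (p : ℂ)⁻¹ * ((p : ℂ) - 1) * quadGauss p F) ∧
      (a = 0 → b ≠ 0 → (traceCount p r a b : ℂ) = (p : ℂ) ^ (n - 1)
        - (p : ℂ)⁻¹ * quadGauss p F) ∧
      (a ≠ 0 → (∃ γ : F, IsGamma p r a γ) ∧ ∀ γ : F, IsGamma p r a γ →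
        (lam p r γ = b → (traceCount p r a b : ℂ) = (p : ℂ) ^ (n - 1)
          + (p : ℂ)⁻¹ * ((p : ℂ) - 1) * quadGauss p F) ∧
        (lam p r γ ≠ b → (traceCount p r a b : ℂ) = (p : ℂ) ^ (n - 1)
          - (p : ℂ)⁻¹ * quadGauss p F))) ∧
    -- (3)
    (Even (n / v) → Odd (n / (2 * v)) →
      (a = 0 → b = 0 → (traceCount p r a b : ℤ) = (p : ℤ) ^ (n - 1)
        - ((p : ℤ) - 1) * (p : ℤ) ^ (t - 1)) ∧
      (a = 0 → b ≠ 0 → (traceCount p r a b : ℤ) = (p : ℤ) ^ (n - 1) + (p : ℤ) ^ (t - 1)) ∧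
      (a ≠ 0 → (∃ γ : F, IsGamma p r a γ) ∧ ∀ γ : F, IsGamma p r a γ →
        (lam p r γ = b → (traceCount p r a b : ℤ) = (p : ℤ) ^ (n - 1)
          - ((p : ℤ) - 1) * (p : ℤ) ^ (t - 1)) ∧
        (lam p r γ ≠ b → (traceCount p r a b : ℤ) = (p : ℤ) ^ (n - 1)
          + (p : ℤ) ^ (t - 1)))) ∧
    -- (4)
    (Even (n / v) → Even (n / (2 * v)) →
      (a = 0 → b = 0 → (traceCount p r a b : ℤ) = (p : ℤ) ^ (n - 1)
        - ((p : ℤ) - 1) * (p : ℤ) ^ (t + v - 1)) ∧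
      (a = 0 → b ≠ 0 → (traceCount p r a b : ℤ) = (p : ℤ) ^ (n - 1)
        + (p : ℤ) ^ (t + v - 1)) ∧
      (a ≠ 0 → ∀ y : ZMod p, y ≠ 0 →
        (ScaledSolvable p r y a →
          (∃ γ : F, IsGamma p r a γ) ∧ ∀ γ : F, IsGamma p r a γ →
            (lam p r γ = b → (traceCount p r a b : ℤ) = (p : ℤ) ^ (n - 1)
              - ((p : ℤ) - 1) * (p : ℤ) ^ (t + v - 1)) ∧
            (lam p r γ ≠ b → (traceCount p r a b : ℤ) = (p : ℤ) ^ (n - 1)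
              + (p : ℤ) ^ (t + v - 1))) ∧
        (¬ ScaledSolvable p r y a →
          (¬ ∃ γ : F, IsGamma p r a γ) ∧ traceCount p r a b = p ^ (n - 1)))) := by
  subst hv ht
  have hp0 : (p : ℂ) ≠ 0 := Nat.cast_ne_zero.2 (Fact.out : p.Prime).ne_zero
  have hv : 0 < n.gcd r := Nat.gcd_pos_of_pos_left r hn
  refine ⟨fun hodd => ?_, fun heven hodd => ?_, fun heven hodd => ?_, fun heven heven2 => ?_⟩
  · have h0 := traceCount_zero_of_odd p hp (F := F) (r := r) hF hodd
    have hz : traceCount p r (0 : F) 0 = p ^ (n - 1) := by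
      have h := h0 0
      rw [quadraticChar_zero, Int.cast_zero, mul_zero, add_zero] at h
      exact_mod_cast h
    refine ⟨fun ha hb => ?_, fun ha _ => ?_, fun _ =>
      ⟨exists_isGamma_of_radical_trivial p (radical_trivial_of_odd_div_gcd p hp hn hF
        (Odd.of_dvd_nat hodd (Nat.div_dvd_of_dvd (Nat.gcd_dvd_left n r)))) a,
        fun γ hγ => ⟨fun hb => ?_, fun _ => ?_⟩⟩⟩
    · rw [ha, hb, hz]
    · rw [ha, h0]
    · rw [traceCount_eq_of_isGamma p r hγ, hb, sub_self, hz]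
    · rw [traceCount_eq_of_isGamma p r hγ, h0]
  · have h0 := traceCount_zero_of_weilSum_const p hn hF (r := r) (S := quadGauss p F)
      fun y hy => by
        rw [weilSum_of_odd_div_gcd p hp hn hF hodd hy]
        obtain ⟨k, rfl⟩ := heven.two_dvd
        rw [pow_mul, quadraticChar_sq_one hy, one_pow, Int.cast_one, one_mul]
    have hz : (traceCount p r (0 : F) 0 : ℂ) = (p : ℂ) ^ (n - 1)
        + (p : ℂ)⁻¹ * ((p : ℂ) - 1) * quadGauss p F := by
      rw [h0, if_pos rfl]
    have hnz (c : ZMod p) (hc : c ≠ 0) : (traceCount p r (0 : F) c : ℂ) = (p : ℂ) ^ (n - 1)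
        - (p : ℂ)⁻¹ * quadGauss p F := by
      rw [h0, if_neg hc]
      ring
    refine ⟨fun ha hb => ?_, fun ha hb => ?_, fun _ =>
      ⟨exists_isGamma_of_radical_trivial p (radical_trivial_of_odd_div_gcd p hp hn hF hodd) a,
        fun γ hγ => ⟨fun hb => ?_, fun hb => ?_⟩⟩⟩
    · rw [ha, hb, hz]
    · rw [ha, hnz b hb]
    · rw [traceCount_eq_of_isGamma p r hγ, hb, sub_self, hz]
    · rw [traceCount_eq_of_isGamma p r hγ, hnz _ (sub_ne_zero.2 (Ne.symm hb))]
  · obtain ⟨m, s, hnm, hrs, hs, hms⟩ := exists_eq_mul_of_even_div_gcd hn heven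
    generalize n.gcd r = v at *
    subst hnm hrs
    rw [Nat.mul_div_cancel_left _ (mul_pos two_pos hv)] at hodd
    have ht : 2 * v * m / 2 = v * m := by rw [mul_assoc, Nat.mul_div_cancel_left _ two_pos]
    rw [ht]
    have h0 := traceCount_zero_of_trivial_radical p hp hv hs hF hodd hms
    have hnz (c : ZMod p) (hc : c ≠ 0) : (traceCount p (v * s) (0 : F) c : ℤ)
        = (p : ℤ) ^ (2 * v * m - 1) + (p : ℤ) ^ (v * m - 1) := by
      rw [h0, if_neg hc]
      ring
    refine ⟨fun ha hb => ?_, fun ha hb => ?_, fun _ =>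
      ⟨exists_isGamma_of_radical_trivial p (radical_trivial_of_odd p hp hF hodd hms) a,
        fun γ hγ => ⟨fun hb => ?_, fun hb => ?_⟩⟩⟩
    · rw [ha, hb, h0, if_pos rfl]
    · rw [ha, hnz b hb]
    · rw [traceCount_eq_of_isGamma p _ hγ, hb, sub_self, h0, if_pos rfl]
    · rw [traceCount_eq_of_isGamma p _ hγ, hnz _ (sub_ne_zero.2 (Ne.symm hb))]
  · obtain ⟨m, s, hnm, hrs, hs, hms⟩ := exists_eq_mul_of_even_div_gcd hn heven
    generalize n.gcd r = v at *
    subst hnm hrs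
    rw [Nat.mul_div_cancel_left _ (mul_pos two_pos hv)] at heven2
    have ht : 2 * v * m / 2 = v * m := by rw [mul_assoc, Nat.mul_div_cancel_left _ two_pos]
    rw [ht]
    have h0 := traceCount_zero_of_nontrivial_radical p hp hv hs (Nat.pos_of_mul_pos_left hn) hF
      heven2 hms
    have hnz (c : ZMod p) (hc : c ≠ 0) : (traceCount p (v * s) (0 : F) c : ℤ)
        = (p : ℤ) ^ (2 * v * m - 1) + (p : ℤ) ^ (v * m + v - 1) := by
      rw [h0, if_neg hc]
      ring
    refine ⟨fun ha hb => ?_, fun ha hb => ?_, fun _ y hy => ?_⟩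
    · rw [ha, hb, h0, if_pos rfl]
    · rw [ha, hnz b hb]
    rw [scaledSolvable_iff p _ hy]
    refine ⟨fun hsol => ⟨hsol, fun γ hγ => ⟨fun hb => ?_, fun hb => ?_⟩⟩, fun hno => ⟨hno, ?_⟩⟩
    · rw [traceCount_eq_of_isGamma p _ hγ, hb, sub_self, h0, if_pos rfl]
    · rw [traceCount_eq_of_isGamma p _ hγ, hnz _ (sub_ne_zero.2 (Ne.symm hb))]
    · obtain ⟨k, hk, hak⟩ := (exists_isGamma_or_exists_trace_ne_zero p _ a).resolve_left hno
      exact traceCount_of_trace_ne_zero p hp hn hF hk hak b
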